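/- **Setting.** Unit $0$ is treated, units $1,2,\dots$ are controls. For $i\ge 0$ and periods $t\le T_1$, potential outcomes follow the linear factor model $y^N_{it}=\boldsymbol\lambda_t\boldsymbol\mu_i+\epsilon_{it}$, $\;y^I_{it}=\alpha_{it}+y^N_{it}$, with non-random factors $\boldsymbol\lambda_t\in\mathbb R^{1\times F}$, loadings $\boldsymbol\mu_i\in\mathbb R^F$ and effects $\alpha_{it}$, and random idiosyncratic shocks $\epsilon_{it}$. The observed $y_{it}$ equals $y^I_{it}$ if $i=0$ and $t>0$, and $y^N_{it}$ otherwise. The pre-treatment periods are $\mathcal T_0=\{-T_0+1,\dots,0\}$, the post-treatment periods $1,\dots,T_1$; the number of controls $J=J(T_0)$ is a function of $T_0$. Let $\mathbf M_J$ be the $J\times F$ matrix with rows $\boldsymbol\mu_1',\dots,\boldsymbol\mu_J'$; let $\boldsymbol\Lambda$ be the $T_0\times F$ matrix with rows $\boldsymbol\lambda_t$, $\mathbf E$ the $T_0\times J$ matrix with entries $\epsilon_{jt}$ ($1\le j\le J$), and $\boldsymbol\epsilon_0$ the vector with entries $\epsilon_{0t}$, where $t\in\mathcal T_0$. Let $\widehat{\mathbf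 b}_{OLS}$ be any minimizer over $\mathbf b\in\mathbb R^J$ (no non-negativity or adding-up constraint) of $\frac1{T_0}\sum_{t\in\mathcal T_0}\bigl(y_{0t}-\sum_{j=1}^J b_jy_{jt}\bigr)^2$, and let $\widehat{\boldsymbol\mu}_{OLS}=\mathbf M_J'\widehat{\mathbf b}_{OLS}$. **Assumptions.** 1. $J/T_0\to c\in[0,1)$ as $T_0\to\infty$. 2. (Idiosyncratic shocks) (a) $\mathbb E[\epsilon_{it}]=0$ for all $i$ and all $t\le T_1$; (b) the processes $\{\epsilon_{it}\}_{t\le T_1}$ are independent across $i$; (c) $\{(\epsilon_{0t},\dots,\epsilon_{Jt})\}_{t\in\mathcal T_0}$ is $\alpha$-mixing, with mixing coefficients tending to zero uniformly in $T_0$; (d) the $\epsilon_{it}$ have uniformly bounded fourth moments, and $\frac1{T_0}\sum_{t\in\mathcal T_0}\mathbb E[\epsilon_{0t}^2]\to\sigma_0^2$ for some $\sigma_0^2$; (e) there is $\underline\gamma>0$ with $\mathbb E[\epsilon_{it}^2]\ge\underline\gamma$ for all $i$ and all $t\le T_1$. 3. (Factor loadings) For some $\underline a,\bar a>0$, let $R$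 be the maximal number of pairwise disjoint groups of $F$ controls among $1,\dots,J$ such that all singular values of the $F\times F$ matrix of loadings of each group lie strictly between $\underline a$ and $\bar a$. Then $R\to\infty$ as $T_0\to\infty$. 4. (Common factors) Let $\mathbf Q$ be the residual-maker matrix of the regression on the linear combinations of the controls that are free of the common factors, that is, the $T_0\times T_0$ matrix of the orthogonal projection onto the orthogonal complement of $\{\mathbf E\mathbf b:\mathbf M_J'\mathbf b=0\}$, and let $K$ be its rank. Then, as $T_0\to\infty$, $\frac1K\boldsymbol\Lambda'\mathbf Q\boldsymbol\Lambda=O_p(1)$; this matrix is invertible with probability approaching one and $\bigl(\frac1K\boldsymbol\Lambda'\mathbf Q\boldsymbol\Lambda\bigr)^{-1}=O_p(1)$; and, if $\mathbf Q$ is independent of $\boldsymbol\epsilon_0$ for every $T_0$, then $\frac1K\boldsymbol\Lambda'\mathbf Q\boldsymbol\epsilon_0=o_p(1)$. **Conclusion.** As $T_0\to\infty$, $\widehat{\boldsymbol\mu}_{OLS}\to\boldsymbol\mu_0$ in probability. -/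

import Mathlib

open Filter Topology MeasureTheory ProbabilityTheory Matrix

noncomputable section

namespace SyntheticControl

/-! ### The linear factor model

Unit `0` is the treated unit, units `1, 2, …` are controls.  Time is indexed by `ℤ`; treatment of
unit `0` starts after time `0`.  `lam t` is the vector of common factors at time `t`, `mu i` the
vector of factor loadings of unit `i`, `eps i t` the idiosyncratic shock, `alpha i t` the effect. -/

/-- Potential outcome without treatment. -/
def untreatedOutcome {Ω : Type*} {F : ℕ} (lam : ℤ → Fin F → ℝ) (mu : ℕ → Fin F → ℝ)
    (eps : ℕ → ℤ → Ω → ℝ) (i : ℕ) (t : ℤ) (ω : Ω) : ℝ :=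
  lam t ⬝ᵥ mu i + eps i t ω

/-- Potential outcome with treatment. -/
def treatedOutcome {Ω : Type*} {F : ℕ} (lam : ℤ → Fin F → ℝ) (mu : ℕ → Fin F → ℝ)
    (alpha : ℕ → ℤ → ℝ) (eps : ℕ → ℤ → Ω → ℝ) (i : ℕ) (t : ℤ) (ω : Ω) : ℝ :=
  alpha i t + untreatedOutcome lam mu eps i t ω

/-- Treatment indicator: only unit `0` is treated, and only after time `0`. -/
def treatmentStatus (i : ℕ) (t : ℤ) : ℝ := if i = 0 ∧ 0 < t then 1 else 0

/-- Observed outcome. -/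
def observedOutcome {Ω : Type*} {F : ℕ} (lam : ℤ → Fin F → ℝ) (mu : ℕ → Fin F → ℝ)
    (alpha : ℕ → ℤ → ℝ) (eps : ℕ → ℤ → Ω → ℝ) (i : ℕ) (t : ℤ) (ω : Ω) : ℝ :=
  treatmentStatus i t * treatedOutcome lam mu alpha eps i t ω
    + (1 - treatmentStatus i t) * untreatedOutcome lam mu eps i t ω

/-- The `T` pre-treatment periods are `0, -1, …, -T + 1`; this is the `k`-th of them. -/
def preTime {T : ℕ} (k : Fin T) : ℤ := -((k : ℕ) : ℤ)

/-- The `J × F` matrix of the loadings of the controls `1, …, J`. -/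
def controlLoadings {F : ℕ} (mu : ℕ → Fin F → ℝ) (J : ℕ) : Matrix (Fin J) (Fin F) ℝ :=
  Matrix.of fun j f => mu ((j : ℕ) + 1) f

/-- The `T × F` matrix of the pre-treatment factors. -/
def factorMatrix {F : ℕ} (lam : ℤ → Fin F → ℝ) (T : ℕ) : Matrix (Fin T) (Fin F) ℝ :=
  Matrix.of fun k f => lam (preTime k) f

/-- The `T × J` matrix of the pre-treatment shocks of the controls `1, …, J`. -/
def controlShocks {Ω : Type*} (eps : ℕ → ℤ → Ω → ℝ) (T J : ℕ) (ω : Ω) :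
    Matrix (Fin T) (Fin J) ℝ :=
  Matrix.of fun k j => eps ((j : ℕ) + 1) (preTime k) ω

/-- The vector of the pre-treatment shocks of the treated unit. -/
def treatedShocks {Ω : Type*} (eps : ℕ → ℤ → Ω → ℝ) (T : ℕ) (ω : Ω) : Fin T → ℝ :=
  fun k => eps 0 (preTime k) ω

/-! ### The unrestricted least-squares weights -/

/-- Mean squared pre-treatment residual of the weights `b`, for outcomes `y i t`. -/
def olsObjective (y : ℕ → ℤ → ℝ) (T J : ℕ) (b : Fin J → ℝ) : ℝ :=
  1 / (T : ℝ) * ∑ k : Fin T,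
    (y 0 (preTime k) - ∑ j : Fin J, b j * y ((j : ℕ) + 1) (preTime k)) ^ 2

/-- `b` is a vector of unrestricted least-squares weights. -/
def IsOLS (y : ℕ → ℤ → ℝ) (T J : ℕ) (b : Fin J → ℝ) : Prop :=
  IsMinOn (olsObjective y T J) Set.univ b

/-- The loadings `M_J' b` implied by the weights `b`. -/
def impliedLoadings {F : ℕ} (mu : ℕ → Fin F → ℝ) (J : ℕ) (b : Fin J → ℝ) : Fin F → ℝ :=
  (controlLoadings mu J)ᵀ *ᵥ b

/-! ### Assumptions on the idiosyncratic shocks -/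

/-- The σ-algebra generated by the shocks of the units `0, …, n` at the times in `S`. -/
abbrev shockSigma {Ω : Type*} (eps : ℕ → ℤ → Ω → ℝ) (n : ℕ) (S : Set ℤ) : MeasurableSpace Ω :=
  ⨆ (i : ℕ) (_ : i ≤ n) (t : ℤ) (_ : t ∈ S), MeasurableSpace.comap (eps i t) inferInstance

/-- Strong (`α`-) mixing over the pre-treatment periods of the array of vector processes
`(eps 0 t, …, eps (J T) t)`, `-T < t ≤ 0`: the mixing coefficients, taken uniformly over the
rows `T`, tend to zero as the gap `m` grows. -/
def IsAlphaMixing {Ω : Type*} [MeasurableSpace Ω] (P : Measure Ω) (eps : ℕ → ℤ → Ω → ℝ)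
    (J : ℕ → ℕ) : Prop :=
  ∃ a : ℕ → ℝ, Tendsto a atTop (𝓝 0) ∧
    ∀ (T m : ℕ) (s : ℤ) (A B : Set Ω),
      MeasurableSet[shockSigma eps (J T) {t | -(T : ℤ) < t ∧ t ≤ 0 ∧ t ≤ s}] A →
      MeasurableSet[shockSigma eps (J T) {t | -(T : ℤ) < t ∧ t ≤ 0 ∧ s + m ≤ t}] B →
      |P.real (A ∩ B) - P.real A * P.real B| ≤ a m

/-- The assumptions on the idiosyncratic shocks; `T₁` is the number of post-treatment periods. -/
structure ShockAssumption {Ω : Type*} [MeasurableSpace Ω] (P : Measure Ω)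
    (eps : ℕ → ℤ → Ω → ℝ) (J : ℕ → ℕ) (T₁ : ℕ) : Prop where
  measurable : ∀ i t, Measurable (eps i t)
  mean_zero : ∀ i, ∀ t : ℤ, t ≤ T₁ → ∫ ω, eps i t ω ∂P = 0
  indep : iIndepFun (fun (i : ℕ) (ω : Ω) (t : {t : ℤ // t ≤ T₁}) => eps i t ω) P
  mixing : IsAlphaMixing P eps J
  fourth_moment : ∃ C : ℝ, ∀ i, ∀ t : ℤ, t ≤ T₁ →
    MemLp (eps i t) 4 P ∧ ∫ ω, eps i t ω ^ 4 ∂P ≤ C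
  treated_variance : ∃ σ : ℝ,
    Tendsto (fun T : ℕ => 1 / (T : ℝ) * ∑ k : Fin T, ∫ ω, eps 0 (preTime k) ω ^ 2 ∂P)
      atTop (𝓝 (σ ^ 2))
  variance_lower : ∃ γ : ℝ, 0 < γ ∧ ∀ i, ∀ t : ℤ, t ≤ T₁ → γ ≤ ∫ ω, eps i t ω ^ 2 ∂P

/-! ### Assumption on the factor loadings -/

/-- All singular values of the square matrix `G` lie strictly between `a` and `b`. -/
def WellConditioned {F : ℕ} (a b : ℝ) (G : Matrix (Fin F) (Fin F) ℝ) : Prop :=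
  ∀ k : Fin F, a < (Matrix.toEuclideanLin G).singularValues k ∧
    (Matrix.toEuclideanLin G).singularValues k < b

/-- The maximal number of pairwise disjoint groups of `F` of the controls `1, …, J` whose
`F × F` matrices of loadings are well conditioned. -/
def groupCount {F : ℕ} (mu : ℕ → Fin F → ℝ) (a b : ℝ) (J : ℕ) : ℕ :=
  sSup {r : ℕ | ∃ g : Fin r × Fin F ↪ Fin J,
    ∀ p : Fin r, WellConditioned a b ((controlLoadings mu J).submatrix (fun k => g (p, k)) id)}

/-! ### Assumption on the common factors -/

/-- `X T = O_p(1)` as `T → ∞`. -/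
def IsBoundedInProbability {Ω : Type*} [MeasurableSpace Ω] (P : Measure Ω)
    (X : ℕ → Ω → ℝ) : Prop :=
  ∀ η : ℝ, 0 < η → ∃ C : ℝ, ∀ᶠ T in atTop, P {ω | C < |X T ω|} ≤ ENNReal.ofReal η

/-- The space `{E b : M_J' b = 0}` of all linear combinations of the controls' pre-treatment
outcomes that are free of the common factors. -/
def factorFreeSpace {Ω : Type*} {F : ℕ} (mu : ℕ → Fin F → ℝ) (eps : ℕ → ℤ → Ω → ℝ)
    (T J : ℕ) (ω : Ω) : Submodule ℝ (EuclideanSpace ℝ (Fin T)) :=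
  (LinearMap.ker (Matrix.toEuclideanLin (controlLoadings mu J)ᵀ)).map
    (Matrix.toEuclideanLin (controlShocks eps T J ω))

/-- The residual-maker matrix of the regression on the factor-free linear combinations of the
controls: the matrix of the orthogonal projection onto the orthogonal complement of
`factorFreeSpace`. -/
def residualMaker {Ω : Type*} {F : ℕ} (mu : ℕ → Fin F → ℝ) (eps : ℕ → ℤ → Ω → ℝ)
    (T J : ℕ) (ω : Ω) : Matrix (Fin T) (Fin T) ℝ :=
  Matrix.toEuclideanLin.symm
    ((factorFreeSpace mu eps T J ω)ᗮ.starProjection :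
      EuclideanSpace ℝ (Fin T) →ₗ[ℝ] EuclideanSpace ℝ (Fin T))

/-- The matrix `(1/K) Λ' Q Λ`, where `K` is the rank of `Q`. -/
def projectedMoment {F : ℕ} (lam : ℤ → Fin F → ℝ) (T : ℕ) (Q : Matrix (Fin T) (Fin T) ℝ) :
    Matrix (Fin F) (Fin F) ℝ :=
  (1 / (Q.rank : ℝ)) • ((factorMatrix lam T)ᵀ * Q * factorMatrix lam T)

/-- The vector `(1/K) Λ' Q e`, where `K` is the rank of `Q`. -/
def projectedCross {F : ℕ} (lam : ℤ → Fin F → ℝ) (T : ℕ) (Q : Matrix (Fin T) (Fin T) ℝ)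
    (e : Fin T → ℝ) : Fin F → ℝ :=
  (1 / (Q.rank : ℝ)) • (((factorMatrix lam T)ᵀ * Q) *ᵥ e)

/-- The assumptions on the common factors for the sequence `Q` of random projection matrices:
`(1/K) Λ' Q Λ = O_p(1)`; this matrix is invertible with probability approaching one and its
inverse is `O_p(1)`; and `(1/K) Λ' Q ε₀ = o_p(1)` if `Q` is independent of `ε₀`. -/
structure FactorAssumption {Ω : Type*} [MeasurableSpace Ω] {F : ℕ} (P : Measure Ω)
    (lam : ℤ → Fin F → ℝ) (eps : ℕ → ℤ → Ω → ℝ)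
    (Q : (T : ℕ) → Ω → Matrix (Fin T) (Fin T) ℝ) : Prop where
  moment_bounded : ∀ f g : Fin F,
    IsBoundedInProbability P (fun T ω => projectedMoment lam T (Q T ω) f g)
  moment_invertible :
    Tendsto (fun T => P {ω | ¬ IsUnit (projectedMoment lam T (Q T ω)).det}) atTop (𝓝 0)
  inverse_bounded : ∀ f g : Fin F,
    IsBoundedInProbability P (fun T ω => (projectedMoment lam T (Q T ω))⁻¹ f g)
  cross_negligible :
    (∀ T, IndepFun (fun (ω : Ω) (k l : Fin T) => Q T ω k l) (treatedShocks eps T) P) →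
      ∀ f : Fin F, TendstoInMeasure P
        (fun T ω => projectedCross lam T (Q T ω) (treatedShocks eps T ω) f) atTop (fun _ => 0)

end SyntheticControl

end

/-!
The least-squares residual is orthogonal to every linear combination of the controls. In particular
it is orthogonal to the factor-free ones, so it is fixed by the projection `Q` onto the orthogonal
complement of `factorFreeSpace`. To remove the weights from the normal equations, take a
deterministic `B` with `M_J' B = 1`. As `b - B M_J' b` is killed by `M_J'`, the vector `E b` may be
replaced by `E B M_J' b` under `Q`, and with `W = Λ + E B` and `d = M_J' b - μ₀` the normal
equations become

  `W' Q (ε₀ - E B μ₀ - W d) = 0`   (`normalEquations`),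

a system of `F` equations in the `F` unknowns `d`, whatever the number of controls.

If `E B` were zero, it would say that `(1/K) Λ' Q Λ d = (1/K) Λ' Q ε₀`; the matrix has a bounded
inverse and the right-hand side is negligible, so `d` is small. The general case is a perturbation of
this one (`sum_abs_sub_le_of_normalEquations`): by Cauchy–Schwarz every further term carries a factor
`‖E B e_f‖ / √K`. That factor vanishes because `B` can be taken to be the average over the `R`
groups of the inverses of their loading matrices (`exists_balancing_weights`). The shocks being
uncorrelated across units, `E B` then has entries of variance `O(1/R)`, so that the squared norms of
its columns are `o_p(T)` (`tendsto_measure_averagedShocks`), while `K ≥ T - J` is of order `T`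
(`eventually_mul_le_rank_residualMaker`).

The assumption on the cross term applies once `Q` is known to be independent of `ε₀`. Since `Q`
depends on the shocks of the controls alone, it is enough that it is a measurable function of them
(`exists_measurable_residualMaker`): `‖Q x‖` is the distance from `x` to `factorFreeSpace`, an
infimum over a countable dense set of weights, and the entries of `Q` are recovered by polarization.
-/

open scoped RealInnerProductSpace

namespace SyntheticControl

/-! ### Perturbed normal equations -/

/-- Cauchy–Schwarz for the projected inner product, with norms measured on the scale `√κ`. -/
lemma abs_inner_starProjection_le {H : Type*} [NormedAddCommGroup H] [InnerProductSpace ℝ H]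
    (U : Submodule ℝ H) [U.HasOrthogonalProjection] {x y : H} {p q κ : ℝ} (hκ : 0 < κ)
    (hp : 0 ≤ p) (hx : ‖U.starProjection x‖ ^ 2 ≤ p ^ 2 * κ)
    (hq : 0 ≤ q) (hy : ‖U.starProjection y‖ ^ 2 ≤ q ^ 2 * κ) :
    |κ⁻¹ * ⟪x, U.starProjection y⟫| ≤ p * q := by
  have h1 : ⟪x, U.starProjection y⟫ = ⟪U.starProjection x, U.starProjection y⟫ := by
    rw [Submodule.inner_starProjection_left_eq_right,
      Submodule.starProjection_eq_self_iff.2 (Submodule.starProjection_apply_mem _ _)]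
  have h2 := abs_real_inner_le_norm (U.starProjection x) (U.starProjection y)
  have h3 : ‖U.starProjection x‖ ≤ p * √κ := by
    refine abs_le_of_sq_le_sq' ?_ (by positivity) |>.2
    rwa [mul_pow, Real.sq_sqrt hκ.le]
  have h4 : ‖U.starProjection y‖ ≤ q * √κ := by
    refine abs_le_of_sq_le_sq' ?_ (by positivity) |>.2
    rwa [mul_pow, Real.sq_sqrt hκ.le]
  rw [abs_mul, abs_of_pos (inv_pos.2 hκ), inv_mul_le_iff₀ hκ, h1]
  calc _ ≤ _ := h2
    _ ≤ (p * √κ) * (q * √κ) := by gcongr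
    _ = κ * (p * q) := by
      rw [mul_mul_mul_comm, Real.mul_self_sqrt hκ.le]; ring

lemma norm_starProjection_sq_le {H : Type*} [NormedAddCommGroup H] [InnerProductSpace ℝ H]
    (U : Submodule ℝ H) [U.HasOrthogonalProjection] {x : H} {a : ℝ} (h : ‖x‖ ^ 2 ≤ a) :
    ‖U.starProjection x‖ ^ 2 ≤ a := by
  refine le_trans ?_ h
  gcongr
  exact U.norm_starProjection_apply_le x

/-- The perturbation bound behind the theorem. In the normal equations for the `l f + e f` projected
to `U`, the `e f` have size `θ √κ`, and the error `u` has size `s √κ` but is nearly uncorrelated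
with the `l f`; then the coefficients `d` are of order `θ`, uniformly over data with given bounds
`D`, `L`, `s`. -/
lemma sum_abs_sub_le_of_normalEquations {H : Type*} [NormedAddCommGroup H]
    [InnerProductSpace ℝ H] {F : ℕ}
    (U : Submodule ℝ H) [U.HasOrthogonalProjection] (l e : Fin F → H) (u : H)
    (m₀ d : Fin F → ℝ)
    (normal : ∀ f, ⟪l f + e f,
      U.starProjection (u - ∑ g, m₀ g • e g - ∑ g, d g • (l g + e g))⟫ = 0)
    {κ D L s θ : ℝ} (hκ : 0 < κ) (hD : 0 ≤ D) (hL : 0 ≤ L) (hs : 0 ≤ s) (hθ : 0 ≤ θ) (hθ₁ : θ ≤ 1)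
    {A : Matrix (Fin F) (Fin F) ℝ} (hA : ∀ f g, A f g = κ⁻¹ * ⟪l f, U.starProjection (l g)⟫)
    (hA_unit : IsUnit A.det) (hA_inv : ∀ f g, |A⁻¹ f g| ≤ D)
    (hA_diag : ∀ f, A f f ≤ L ^ 2)
    (he : ∀ f, ‖e f‖ ^ 2 ≤ θ ^ 2 * κ) (hu : ‖u‖ ^ 2 ≤ s ^ 2 * κ)
    (hlu : ∀ f, |κ⁻¹ * ⟪l f, U.starProjection u⟫| ≤ θ)
    (hsmall : θ * ((F : ℝ) ^ 2 * D * (2 * L + 1)) ≤ 1 / 2) :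
    ∑ f, |d f| ≤ θ * (2 * (F : ℝ) ^ 2 * D * (1 + s + (2 * L + 1) * ∑ f, |m₀ f|)) := by
  have hl : ∀ f, ‖U.starProjection (l f)‖ ^ 2 ≤ L ^ 2 * κ := by
    intro f
    have h := hA_diag f
    rw [hA, inv_mul_le_iff₀ hκ] at h
    have h1 : ⟪l f, U.starProjection (l f)⟫ = ‖U.starProjection (l f)‖ ^ 2 := by
      rw [← real_inner_self_eq_norm_sq, Submodule.inner_starProjection_left_eq_right,
        Submodule.starProjection_eq_self_iff.2 (Submodule.starProjection_apply_mem _ _)]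
    linarith
  have he' := fun f => norm_starProjection_sq_le U (he f)
  have hu' := norm_starProjection_sq_le U hu
  have hll := fun f g => abs_inner_starProjection_le U hκ hL (hl f) hL (hl g)
  have hle := fun f g => abs_inner_starProjection_le U hκ hL (hl f) hθ (he' g)
  have hel := fun f g => abs_inner_starProjection_le U hκ hθ (he' f) hL (hl g)
  have hee := fun f g => abs_inner_starProjection_le U hκ hθ (he' f) hθ (he' g)
  have heu := fun f => abs_inner_starProjection_le U hκ hθ (he' f) hs hu'
  -- Solve the normal equations for the unperturbed moments `A d`; all that remains is `O(θ)`.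
  have hAd : ∀ f, |(A *ᵥ d) f| ≤
      θ * (1 + s + (2 * L + 1) * ∑ g, |m₀ g| + (2 * L + 1) * ∑ g, |d g|) := by
    intro f
    have key : (A *ᵥ d) f = κ⁻¹ * ⟪l f, U.starProjection u⟫ + κ⁻¹ * ⟪e f, U.starProjection u⟫
        - ∑ g, m₀ g * (κ⁻¹ * ⟪l f, U.starProjection (e g)⟫ + κ⁻¹ * ⟪e f, U.starProjection (e g)⟫)
        - ∑ g, d g * (κ⁻¹ * ⟪l f, U.starProjection (e g)⟫ + κ⁻¹ * ⟪e f, U.starProjection (l g)⟫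
            + κ⁻¹ * ⟪e f, U.starProjection (e g)⟫) := by
      have h := normal f
      simp only [map_sub, map_sum, map_smul, map_add, inner_sub_right, inner_sum, inner_add_left,
        inner_add_right, inner_smul_right] at h
      have h' := congrArg (fun x => κ⁻¹ * x) h
      simp only [mul_zero] at h'
      have hmv : (A *ᵥ d) f = ∑ g, d g * (κ⁻¹ * ⟪l f, U.starProjection (l g)⟫) := by
        simp only [Matrix.mulVec, dotProduct, hA]
        exact Finset.sum_congr rfl fun g _ => mul_comm _ _
      rw [hmv]
      simp only [mul_add, Finset.sum_add_distrib, mul_sub, Finset.mul_sum] at h' ⊢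
      simp only [mul_left_comm _ κ⁻¹] at h' ⊢
      linarith
    have b1 : |∑ g, m₀ g * (κ⁻¹ * ⟪l f, U.starProjection (e g)⟫
        + κ⁻¹ * ⟪e f, U.starProjection (e g)⟫)| ≤ θ * ((2 * L + 1) * ∑ g, |m₀ g|) := by
      rw [Finset.mul_sum, Finset.mul_sum]
      refine (Finset.abs_sum_le_sum_abs _ _).trans (Finset.sum_le_sum fun g _ => ?_)
      rw [abs_mul]
      have h3 : |κ⁻¹ * ⟪l f, U.starProjection (e g)⟫ + κ⁻¹ * ⟪e f, U.starProjection (e g)⟫|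
          ≤ θ * (2 * L + 1) := by
        refine (abs_add_le _ _).trans ?_
        nlinarith [hle f g, hee f g]
      calc _ ≤ |m₀ g| * (θ * (2 * L + 1)) := by gcongr
        _ = _ := by ring
    have b2 : |∑ g, d g * (κ⁻¹ * ⟪l f, U.starProjection (e g)⟫
        + κ⁻¹ * ⟪e f, U.starProjection (l g)⟫
        + κ⁻¹ * ⟪e f, U.starProjection (e g)⟫)| ≤ θ * ((2 * L + 1) * ∑ g, |d g|) := by
      rw [Finset.mul_sum, Finset.mul_sum]
      refine (Finset.abs_sum_le_sum_abs _ _).trans (Finset.sum_le_sum fun g _ => ?_)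
      rw [abs_mul]
      have h3 : |κ⁻¹ * ⟪l f, U.starProjection (e g)⟫ + κ⁻¹ * ⟪e f, U.starProjection (l g)⟫
          + κ⁻¹ * ⟪e f, U.starProjection (e g)⟫| ≤ θ * (2 * L + 1) := by
        refine (abs_add_three _ _ _).trans ?_
        nlinarith [hle f g, hee f g, hel f g]
      calc _ ≤ |d g| * (θ * (2 * L + 1)) := by gcongr
        _ = _ := by ring
    rw [key]
    have b3 := hlu f
    have b4 := heu f
    rw [abs_le] at *
    constructor <;> linarith [b1.1, b1.2, b2.1, b2.2, b3.1, b3.2, b4.1, b4.2]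
  set X := θ * (1 + s + (2 * L + 1) * ∑ g, |m₀ g| + (2 * L + 1) * ∑ g, |d g|) with hX
  have hd : ∀ f, |d f| ≤ F * (D * X) := by
    intro f
    have h : d f = ∑ g, A⁻¹ f g * (A *ᵥ d) g := by
      have : A⁻¹ *ᵥ (A *ᵥ d) = d := by
        rw [Matrix.mulVec_mulVec, Matrix.nonsing_inv_mul _ hA_unit, Matrix.one_mulVec]
      exact (congrFun this f).symm
    rw [h]
    refine (Finset.abs_sum_le_sum_abs _ _).trans ?_
    calc _ ≤ ∑ g : Fin F, D * X := by
          refine Finset.sum_le_sum fun g _ => ?_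
          rw [abs_mul]
          exact mul_le_mul (hA_inv f g) (hAd g) (abs_nonneg _) hD
      _ = _ := by simp
  have hsum : ∑ f, |d f| ≤ F * (F * (D * X)) := by
    refine (Finset.sum_le_sum fun f _ => hd f).trans ?_
    simp
  have hd0 : 0 ≤ ∑ f, |d f| := Finset.sum_nonneg fun _ _ => abs_nonneg _
  -- By `hsmall`, the part of the bound proportional to `∑ |d f|` is at most half of that sum, so it
  -- is absorbed on the left.
  have := mul_le_mul_of_nonneg_right hsmall hd0
  rw [hX] at hsum
  nlinarith

/-! ### The normal equations -/

/-- Column `f` of the matrix `A`, as a Euclidean vector. -/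
noncomputable def euclideanCol {m n : ℕ} (A : Matrix (Fin m) (Fin n) ℝ) (f : Fin n) :
    EuclideanSpace ℝ (Fin m) :=
  WithLp.toLp 2 fun k => A k f

lemma toEuclideanLin_eq_sum_col {m n : ℕ} (A : Matrix (Fin m) (Fin n) ℝ) (v : Fin n → ℝ) :
    Matrix.toEuclideanLin A (WithLp.toLp 2 v) = ∑ f, v f • euclideanCol A f := by
  ext k
  simp [euclideanCol, Matrix.mulVec, dotProduct, mul_comm]

section NormalEquations
variable {Ω : Type*} {F : ℕ} (lam : ℤ → Fin F → ℝ) (mu : ℕ → Fin F → ℝ)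
  (alpha : ℕ → ℤ → ℝ) (eps : ℕ → ℤ → Ω → ℝ)

lemma observedOutcome_preTime (i : ℕ) {T : ℕ} (k : Fin T) (ω : Ω) :
    observedOutcome lam mu alpha eps i (preTime k) ω
      = lam (preTime k) ⬝ᵥ mu i + eps i (preTime k) ω := by
  have : ¬ (0 : ℤ) < preTime k := by simp [preTime]
  simp [observedOutcome, treatmentStatus, this, untreatedOutcome]

/-- The least-squares residual is orthogonal to every combination of the controls. The
assumption `0 < T` serves to cancel the factor `1 / T` of `olsObjective`. -/
lemma inner_residual_eq_zero {T J : ℕ} (hT : 0 < T) {ω : Ω} {b : Fin J → ℝ}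
    (hb : IsOLS (fun i t => observedOutcome lam mu alpha eps i t ω) T J b) (v : Fin J → ℝ) :
    ⟪Matrix.toEuclideanLin (factorMatrix lam T) (WithLp.toLp 2 (impliedLoadings mu J v))
        + Matrix.toEuclideanLin (controlShocks eps T J ω) (WithLp.toLp 2 v),
      Matrix.toEuclideanLin (factorMatrix lam T) (WithLp.toLp 2 (mu 0))
        + WithLp.toLp 2 (treatedShocks eps T ω)
        - (Matrix.toEuclideanLin (factorMatrix lam T) (WithLp.toLp 2 (impliedLoadings mu J b))
        + Matrix.toEuclideanLin (controlShocks eps T J ω) (WithLp.toLp 2 b))⟫ = 0 := by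
  set Y : Matrix (Fin T) (Fin J) ℝ :=
    factorMatrix lam T * (controlLoadings mu J)ᵀ + controlShocks eps T J ω with hY
  have hYv : ∀ v : Fin J → ℝ,
      Matrix.toEuclideanLin (factorMatrix lam T) (WithLp.toLp 2 (impliedLoadings mu J v))
        + Matrix.toEuclideanLin (controlShocks eps T J ω) (WithLp.toLp 2 v)
        = Matrix.toEuclideanLin Y (WithLp.toLp 2 v) := by
    intro v
    simp [hY, impliedLoadings]
  rw [hYv, hYv]
  set y := Matrix.toEuclideanLin (factorMatrix lam T) (WithLp.toLp 2 (mu 0))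
        + WithLp.toLp 2 (treatedShocks eps T ω) with hy
  have hobj : ∀ v : Fin J → ℝ,
      olsObjective (fun i t => observedOutcome lam mu alpha eps i t ω) T J v
        = 1 / (T : ℝ) * ‖y - Matrix.toEuclideanLin Y (WithLp.toLp 2 v)‖ ^ 2 := by
    intro v
    rw [olsObjective, EuclideanSpace.norm_sq_eq]
    congr 1
    refine Finset.sum_congr rfl fun k _ => ?_
    rw [Real.norm_eq_abs, sq_abs]
    congr 1
    simp only [observedOutcome_preTime, hy, PiLp.sub_apply, PiLp.add_apply,
      Matrix.ofLp_toLpLin, Matrix.toLin'_apply]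
    congr 1
    simp only [Matrix.mulVec, dotProduct, hY, Matrix.add_apply, Matrix.mul_apply]
    refine Finset.sum_congr rfl fun j _ => ?_
    simp [factorMatrix, controlLoadings, controlShocks, mul_comm]
  have hmin : ∀ v : Fin J → ℝ, ‖y - Matrix.toEuclideanLin Y (WithLp.toLp 2 b)‖
      ≤ ‖y - Matrix.toEuclideanLin Y (WithLp.toLp 2 v)‖ := by
    intro v
    have h := hb (Set.mem_univ v)
    simp only [Set.mem_ofPred_eq] at h
    rw [hobj, hobj] at h
    have hT' : (0 : ℝ) < 1 / (T : ℝ) := by positivity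
    exact abs_le_of_sq_le_sq' (le_of_mul_le_mul_left h hT') (norm_nonneg _) |>.2
  have hinf : ‖y - Matrix.toEuclideanLin Y (WithLp.toLp 2 b)‖
      = ⨅ w : (LinearMap.range (Matrix.toEuclideanLin Y)), ‖y - w‖ := by
    refine le_antisymm (le_ciInf ?_) (ciInf_le ⟨0, ?_⟩
      (⟨_, LinearMap.mem_range_self _ _⟩ : LinearMap.range (Matrix.toEuclideanLin Y)))
    · rintro ⟨_, w, rfl⟩
      exact hmin (WithLp.ofLp w)
    · rintro _ ⟨w, rfl⟩
      exact norm_nonneg _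
  rw [real_inner_comm]
  exact (Submodule.norm_eq_iInf_iff_real_inner_eq_zero _ (LinearMap.mem_range_self _ _)).1 hinf _
    (LinearMap.mem_range_self _ _)

/-- The normal equations of the regression, written in terms of the implied loadings: `B` is any
right inverse of the transposed control loadings, and the residual maker absorbs the difference
between the weights and `B` applied to their implied loadings. -/
lemma normalEquations {T J : ℕ} (hT : 0 < T) {ω : Ω} {b : Fin J → ℝ}
    (hb : IsOLS (fun i t => observedOutcome lam mu alpha eps i t ω) T J b)
    {B : Matrix (Fin J) (Fin F) ℝ} (hB : (controlLoadings mu J)ᵀ * B = 1) (f : Fin F) :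
    ⟪euclideanCol (factorMatrix lam T) f + euclideanCol (controlShocks eps T J ω * B) f,
      (factorFreeSpace mu eps T J ω)ᗮ.starProjection
        (WithLp.toLp 2 (treatedShocks eps T ω)
          - ∑ g, mu 0 g • euclideanCol (controlShocks eps T J ω * B) g
          - ∑ g, (impliedLoadings mu J b - mu 0) g •
            (euclideanCol (factorMatrix lam T) g
              + euclideanCol (controlShocks eps T J ω * B) g))⟫ = 0 := by
  set E := controlShocks eps T J ω with hE
  set Λ := factorMatrix lam T with hΛ
  set S := factorFreeSpace mu eps T J ω with hS
  set m := impliedLoadings mu J b with hm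
  have horth := inner_residual_eq_zero lam mu alpha eps hT hb
  set r := Matrix.toEuclideanLin Λ (WithLp.toLp 2 (mu 0))
        + WithLp.toLp 2 (treatedShocks eps T ω)
        - (Matrix.toEuclideanLin Λ (WithLp.toLp 2 m)
        + Matrix.toEuclideanLin E (WithLp.toLp 2 b)) with hr
  have hrS : r ∈ Sᗮ := by
    rw [Submodule.mem_orthogonal]
    rintro _ ⟨v, hv, rfl⟩
    have h := horth (WithLp.ofLp v)
    have hv' : impliedLoadings mu J (WithLp.ofLp v) = 0 := by
      have := congrArg WithLp.ofLp (LinearMap.mem_ker.1 hv)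
      simpa [impliedLoadings] using this
    rw [hv'] at h
    simpa using h
  have hdiff : b - B *ᵥ m ∈ LinearMap.ker (Matrix.mulVecLin (controlLoadings mu J)ᵀ) := by
    rw [LinearMap.mem_ker, Matrix.mulVecLin_apply, Matrix.mulVec_sub, Matrix.mulVec_mulVec, hB,
      Matrix.one_mulVec, hm, impliedLoadings, sub_self]
  have hEd : Matrix.toEuclideanLin E (WithLp.toLp 2 (b - B *ᵥ m)) ∈ S := by
    refine ⟨_, ?_, rfl⟩
    have := LinearMap.mem_ker.1 hdiff
    rw [Matrix.mulVecLin_apply] at this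
    simp [Matrix.toLpLin_apply, this]
  -- The argument of the projection is the residual up to an element of `factorFreeSpace`.
  have hproj : Sᗮ.starProjection (WithLp.toLp 2 (treatedShocks eps T ω)
          - ∑ g, mu 0 g • euclideanCol (E * B) g
          - ∑ g, (m - mu 0) g • (euclideanCol Λ g + euclideanCol (E * B) g)) = r := by
    have h1 : WithLp.toLp 2 (treatedShocks eps T ω)
          - ∑ g, mu 0 g • euclideanCol (E * B) g
          - ∑ g, (m - mu 0) g • (euclideanCol Λ g + euclideanCol (E * B) g)
        = r + Matrix.toEuclideanLin E (WithLp.toLp 2 (b - B *ᵥ m)) := by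
      simp only [smul_add, Finset.sum_add_distrib, ← toEuclideanLin_eq_sum_col, hr, WithLp.toLp_sub,
        map_sub]
      have : Matrix.toEuclideanLin E (WithLp.toLp 2 (B *ᵥ m))
          = Matrix.toEuclideanLin (E * B) (WithLp.toLp 2 m) := by
        simp
      rw [this]
      abel
    rw [h1, map_add, Submodule.starProjection_eq_self_iff.2 hrS,
      (Submodule.starProjection_apply_eq_zero_iff _).2 (Submodule.le_orthogonal_orthogonal _ hEd),
      add_zero]
  rw [hproj]
  -- The weights in column `f` of `B` load on factor `f` only.
  have hBf : impliedLoadings mu J (B.col f) = Pi.single f 1 := by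
    rw [impliedLoadings]
    ext g
    have := congrFun (congrFun hB g) f
    rw [Matrix.mul_apply] at this
    simp only [Matrix.mulVec, dotProduct, Matrix.col_apply, this, Matrix.one_apply, Pi.single_apply]
  have h := horth (B.col f)
  rw [hBf] at h
  convert h using 3
  · ext k; simp [euclideanCol, hΛ]
  · ext k; simp [euclideanCol, Matrix.mul_apply, Matrix.mulVec, dotProduct]; rfl

/-! ### The rank of the residual maker and the projected moments -/

/-- `factorFreeSpace` has dimension at most `J`, so the residual maker has rank at least `T - J`. -/
lemma le_rank_residualMaker_add (T J : ℕ) (ω : Ω) :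
    T ≤ (residualMaker mu eps T J ω).rank + J := by
  set S := factorFreeSpace mu eps T J ω with hS
  have h1 : (residualMaker mu eps T J ω).rank = Module.finrank ℝ Sᗮ := by
    have : LinearMap.range (Matrix.toEuclideanLin (residualMaker mu eps T J ω)) = Sᗮ := by
      rw [residualMaker, LinearEquiv.apply_symm_apply]
      exact Submodule.range_starProjection _
    rw [← this, Matrix.rank_eq_finrank_range_toLin _ (PiLp.basisFun 2 ℝ (Fin T))
      (PiLp.basisFun 2 ℝ (Fin T)), ← Matrix.toLpLin_eq_toLin]
  have h2 := Submodule.finrank_add_finrank_orthogonal S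
  have h3 : Module.finrank ℝ S ≤ J := by
    refine (Submodule.finrank_map_le _ _).trans ((Submodule.finrank_le _).trans ?_)
    simp
  rw [finrank_euclideanSpace_fin] at h2
  omega

lemma residualMaker_mulVec (T J : ℕ) (ω : Ω) (x : Fin T → ℝ) :
    residualMaker mu eps T J ω *ᵥ x
      = WithLp.ofLp ((factorFreeSpace mu eps T J ω)ᗮ.starProjection (WithLp.toLp 2 x)) := by
  rw [← Matrix.toLin'_apply, ← Matrix.ofLp_toLpLin 2 2 _ (WithLp.toLp 2 x), residualMaker,
    LinearEquiv.apply_symm_apply]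
  rfl

lemma projectedCross_residualMaker (T J : ℕ) (ω : Ω) (x : Fin T → ℝ) (f : Fin F) :
    projectedCross lam T (residualMaker mu eps T J ω) x f
      = ((residualMaker mu eps T J ω).rank : ℝ)⁻¹ * ⟪euclideanCol (factorMatrix lam T) f,
        (factorFreeSpace mu eps T J ω)ᗮ.starProjection (WithLp.toLp 2 x)⟫ := by
  rw [projectedCross, ← Matrix.mulVec_mulVec, residualMaker_mulVec]
  simp [euclideanCol, PiLp.inner_apply, Matrix.mulVec, dotProduct, mul_comm]

lemma projectedMoment_residualMaker (T J : ℕ) (ω : Ω) (f g : Fin F) :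
    projectedMoment lam T (residualMaker mu eps T J ω) f g
      = ((residualMaker mu eps T J ω).rank : ℝ)⁻¹ * ⟪euclideanCol (factorMatrix lam T) f,
        (factorFreeSpace mu eps T J ω)ᗮ.starProjection
          (euclideanCol (factorMatrix lam T) g)⟫ := by
  rw [euclideanCol, euclideanCol, ← euclideanCol, ← projectedCross_residualMaker, projectedMoment,
    projectedCross]
  simp only [Matrix.smul_apply, Pi.smul_apply]
  rfl
end NormalEquations

/-! ### Averaging well-conditioned groups of controls -/

/-- A linear map expands norms at least by its smallest singular value. -/
lemma sq_mul_norm_sq_le_of_singularValues {E : Type*} [NormedAddCommGroup E]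
    [InnerProductSpace ℝ E] [FiniteDimensional ℝ E] {n : ℕ} (hn : Module.finrank ℝ E = n)
    (S : E →ₗ[ℝ] E) {a : ℝ} (ha : 0 ≤ a) (h : ∀ k : Fin n, a ≤ S.singularValues k) (x : E) :
    a ^ 2 * ‖x‖ ^ 2 ≤ ‖S x‖ ^ 2 := by
  set v := S.isSymmetric_adjoint_comp_self.eigenvectorBasis hn with hv
  have h1 : ‖S x‖ ^ 2 = ∑ k : Fin n, S.singularValues k ^ 2 * v.repr x k ^ 2 := by
    rw [← real_inner_self_eq_norm_sq, ← LinearMap.adjoint_inner_left,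
      ← v.repr.inner_map_map, PiLp.inner_apply]
    refine Finset.sum_congr rfl fun k _ => ?_
    have := S.isSymmetric_adjoint_comp_self.eigenvectorBasis_apply_self_apply hn x k
    rw [LinearMap.comp_apply] at this
    rw [hv, this, S.sq_singularValues_fin hn]
    simp
    ring
  have h2 : ‖x‖ ^ 2 = ∑ k, v.repr x k ^ 2 := by
    rw [← v.repr.norm_map, EuclideanSpace.norm_sq_eq]
    simp
  rw [h1, h2, Finset.mul_sum]
  gcongr with k
  exact h k

lemma WellConditioned.exists_inverse {F : ℕ} {a b : ℝ} (ha : 0 < a)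
    {G : Matrix (Fin F) (Fin F) ℝ} (hG : WellConditioned a b G) :
    Gᵀ * G⁻¹ᵀ = 1 ∧ ∀ f k, (G⁻¹ f k) ^ 2 ≤ (a ^ 2)⁻¹ := by
  have hbound := sq_mul_norm_sq_le_of_singularValues (finrank_euclideanSpace_fin (n := F))
    (Matrix.toEuclideanLin G) ha.le fun k => (hG k).1.le
  have hinj : Function.Injective G.mulVec := by
    have : Function.Injective (Matrix.toEuclideanLin G) := by
      refine (injective_iff_map_eq_zero _).2 fun x hx => ?_
      have h := hbound x
      rw [hx, norm_zero] at h
      have : ‖x‖ ^ 2 ≤ 0 := by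
        have ha2 : 0 < a ^ 2 := by positivity
        nlinarith
      exact norm_eq_zero.1 (by nlinarith [norm_nonneg x])
    intro x y hxy
    have h := @this (WithLp.toLp 2 x) (WithLp.toLp 2 y) (by
      simpa using congrArg (WithLp.toLp 2) hxy)
    exact congrArg WithLp.ofLp h
  have hunit : IsUnit G := Matrix.mulVec_injective_iff_isUnit.1 hinj
  have hdet := (Matrix.isUnit_iff_isUnit_det G).1 hunit
  refine ⟨?_, fun f k => ?_⟩
  · rw [← Matrix.transpose_mul, Matrix.nonsing_inv_mul _ hdet, Matrix.transpose_one]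
  · have h := hbound (WithLp.toLp 2 (G⁻¹ *ᵥ Pi.single k 1))
    have h1 : Matrix.toEuclideanLin G (WithLp.toLp 2 (G⁻¹ *ᵥ Pi.single k 1))
        = EuclideanSpace.single k 1 := by
      rw [Matrix.toLpLin_toLp, Matrix.toLin'_apply, Matrix.mulVec_mulVec,
        Matrix.mul_nonsing_inv _ hdet, Matrix.one_mulVec]
      rfl
    rw [h1, PiLp.norm_single, norm_one, one_pow] at h
    have h2 := EuclideanSpace.norm_sq_eq (𝕜 := ℝ) (WithLp.toLp 2 (G⁻¹ *ᵥ Pi.single k 1))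
    have h3 : (G⁻¹ f k) ^ 2 ≤
        ‖(WithLp.toLp 2 (G⁻¹ *ᵥ Pi.single k 1) : EuclideanSpace ℝ (Fin F))‖ ^ 2 := by
      rw [h2]
      refine le_trans (le_of_eq ?_) (Finset.single_le_sum (fun i _ => sq_nonneg _)
        (Finset.mem_univ f))
      simp
    have ha2 : 0 < a ^ 2 := by positivity
    refine h3.trans ?_
    rwa [← mul_one (a ^ 2)⁻¹, ← div_eq_inv_mul, le_div_iff₀' ha2]

/-- The average over a maximal family of disjoint well-conditioned groups of the inverses of their
loading matrices: weights that reproduce each factor exactly, with squares of total size `O(1/R)`. -/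
lemma exists_balancing_weights {F : ℕ} (mu : ℕ → Fin F → ℝ) {a b : ℝ} (ha : 0 < a) {J : ℕ}
    (hR : 0 < groupCount mu a b J) :
    ∃ B : Matrix (Fin J) (Fin F) ℝ, (controlLoadings mu J)ᵀ * B = 1 ∧
      ∀ f, ∑ j, B j f ^ 2 ≤ F * (a ^ 2)⁻¹ * (groupCount mu a b J : ℝ)⁻¹ := by
  set R := groupCount mu a b J with hRdef
  obtain ⟨g, hg⟩ : R ∈ {r : ℕ | ∃ g : Fin r × Fin F ↪ Fin J,
      ∀ p : Fin r, WellConditioned a b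
        ((controlLoadings mu J).submatrix (fun k => g (p, k)) id)} := by
    refine Nat.sSup_mem ?_ ?_
    · by_contra h
      rw [Set.not_nonempty_iff_eq_empty] at h
      rw [hRdef, groupCount, h] at hR
      simp at hR
    -- An unbounded set of naturals has supremum `0`, which `hR` excludes.
    · by_contra h
      rw [hRdef, groupCount, Nat.sSup_of_not_bddAbove h] at hR
      exact lt_irrefl _ hR
  set G : Fin R → Matrix (Fin F) (Fin F) ℝ :=
    fun p => (controlLoadings mu J).submatrix (fun k => g (p, k)) id with hG
  have hR' : (0 : ℝ) < R := by exact_mod_cast hR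
  let B : Matrix (Fin J) (Fin F) ℝ := Matrix.of fun j f =>
    Function.extend g (fun q : Fin R × Fin F => (R : ℝ)⁻¹ * (G q.1)⁻¹ f q.2) 0 j
  have hBg : ∀ q f, B (g q) f = (R : ℝ)⁻¹ * (G q.1)⁻¹ f q.2 := fun q f => by
    simp only [B, Matrix.of_apply]
    rw [g.injective.extend_apply]
  have hB0 : ∀ j ∉ Set.range g, ∀ f, B j f = 0 := fun j hj f => by
    simp only [B, Matrix.of_apply]
    rw [Function.extend_apply' _ _ _ (by simpa using hj)]
    rfl
  have hsum : ∀ φ : Fin J → ℝ, (∀ j ∉ Set.range g, φ j = 0) →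
      ∑ j, φ j = ∑ p, ∑ k, φ (g (p, k)) := fun φ hφ => by
    rw [← Fintype.sum_prod_type' (fun p k => φ (g (p, k)))]
    exact (Finset.sum_of_injOn g g.injective.injOn (by simp) (fun j _ hj => hφ j (by simpa using hj))
      fun _ _ => rfl).symm
  refine ⟨B, ?_, fun f => ?_⟩
  · ext f' f
    rw [Matrix.mul_apply, hsum _ fun j hj => by rw [hB0 j hj, mul_zero]]
    have hp : ∀ p, ∑ k, (controlLoadings mu J)ᵀ f' (g (p, k)) * B (g (p, k)) f
        = (R : ℝ)⁻¹ * (1 : Matrix (Fin F) (Fin F) ℝ) f' f := fun p => by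
      rw [← (WellConditioned.exists_inverse ha (hg p)).1, Matrix.mul_apply, Finset.mul_sum]
      refine Finset.sum_congr rfl fun k _ => ?_
      rw [hBg]
      simp only [hG, Matrix.transpose_apply, Matrix.submatrix_apply, id_eq]
      ring
    rw [Finset.sum_congr rfl fun p _ => hp p]
    simp [hR'.ne']
  · rw [hsum _ fun j hj => by rw [hB0 j hj]; simp]
    calc _ ≤ ∑ p : Fin R, ∑ k : Fin F, ((R : ℝ)⁻¹) ^ 2 * (a ^ 2)⁻¹ := by
          gcongr with p _ k _
          rw [hBg, mul_pow]
          gcongr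
          exact (WellConditioned.exists_inverse ha (hg p)).2 f k
      _ = _ := by
        simp
        field_simp

/-! ### Measurability of the residual maker -/

lemma norm_starProjection_orthogonal_eq_infDist {H : Type*} [NormedAddCommGroup H]
    [InnerProductSpace ℝ H] (S : Submodule ℝ H) [S.HasOrthogonalProjection] (x : H) :
    ‖Sᗮ.starProjection x‖ = Metric.infDist x S := by
  have h : Sᗮ.starProjection x = x - S.starProjection x :=
    Submodule.starProjection_orthogonal_val x
  rw [h, Submodule.starProjection_minimal, Metric.infDist_eq_iInf]
  simp only [dist_eq_norm]
  rfl

/-- The matrix is given by its columns `E j`, one for each control, so that units come before times as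
in the independence assumption. -/
lemma measurable_norm_starProjection_map {T J : ℕ}
    (N : Submodule ℝ (EuclideanSpace ℝ (Fin J))) (x : EuclideanSpace ℝ (Fin T)) :
    Measurable fun E : Fin J → Fin T → ℝ =>
      ‖(N.map (Matrix.toEuclideanLin (Matrix.of fun k j => E j k)))ᗮ.starProjection x‖ := by
  simp only [norm_starProjection_orthogonal_eq_infDist]
  refine measurable_of_Iio fun r => ?_
  obtain ⟨D, hDc, hDd⟩ := TopologicalSpace.exists_countable_dense N
  have hcont : ∀ v : EuclideanSpace ℝ (Fin J), Continuous fun E : Fin J → Fin T → ℝ =>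
      dist x (Matrix.toEuclideanLin (Matrix.of fun k j => E j k) v) := by
    intro v
    refine continuous_const.dist ((PiLp.continuous_toLp 2 _).comp ?_)
    refine continuous_pi fun k => ?_
    simp only [Matrix.toLin'_apply, Matrix.mulVec, dotProduct,
      Matrix.of_apply, LinearEquiv.coe_coe]
    fun_prop
  have hset : (fun E : Fin J → Fin T → ℝ => Metric.infDist x
      (N.map (Matrix.toEuclideanLin (Matrix.of fun k j => E j k)) :
        Set (EuclideanSpace ℝ (Fin T)))) ⁻¹' Set.Iio r
      = ⋃ v ∈ D, {E | dist x (Matrix.toEuclideanLin (Matrix.of fun k j => E j k) v) < r} := by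
    ext E
    simp only [Set.mem_preimage, Set.mem_Iio, Set.mem_iUnion, Set.mem_ofPred_eq]
    rw [Metric.infDist_lt_iff (Submodule.nonempty _)]
    -- The distance is below `r` on an open set of weights, which meets the dense set `D`.
    constructor
    · rintro ⟨_, ⟨v, hv, rfl⟩, hlt⟩
      have hopen : IsOpen {w : N |
          dist x (Matrix.toEuclideanLin (Matrix.of fun k j => E j k) w) < r} := by
        refine isOpen_lt (continuous_const.dist ?_) continuous_const
        exact (LinearMap.continuous_of_finiteDimensional _).comp continuous_subtype_val
      obtain ⟨w, hw, hwD⟩ := hDd.exists_mem_open hopen ⟨⟨v, hv⟩, hlt⟩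
      exact ⟨w, hw, hwD⟩
    · rintro ⟨w, hw, hlt⟩
      exact ⟨_, ⟨w, w.2, rfl⟩, hlt⟩
  rw [hset]
  exact MeasurableSet.biUnion hDc fun v _ => (isOpen_lt (hcont v) continuous_const).measurableSet

lemma residualMaker_apply_eq_polarization {Ω : Type*} {F : ℕ} (mu : ℕ → Fin F → ℝ)
    (eps : ℕ → ℤ → Ω → ℝ) (T J : ℕ) (ω : Ω) (k l : Fin T) :
    residualMaker mu eps T J ω k l
      = (‖(factorFreeSpace mu eps T J ω)ᗮ.starProjection
            (EuclideanSpace.single k 1 + EuclideanSpace.single l 1)‖ ^ 2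
        - ‖(factorFreeSpace mu eps T J ω)ᗮ.starProjection
            (EuclideanSpace.single k 1 - EuclideanSpace.single l 1)‖ ^ 2) / 4 := by
  set U := (factorFreeSpace mu eps T J ω)ᗮ
  have h1 : residualMaker mu eps T J ω k l
      = ⟪EuclideanSpace.single k (1 : ℝ), U.starProjection (EuclideanSpace.single l 1)⟫ := by
    have h := congrFun (residualMaker_mulVec mu eps T J ω (Pi.single l 1)) k
    rw [Matrix.mulVec_single_one] at h
    rw [EuclideanSpace.inner_single_left, map_one, one_mul]
    exact h
  have h2 : ⟪U.starProjection (EuclideanSpace.single k (1 : ℝ)),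
      U.starProjection (EuclideanSpace.single l 1)⟫
      = ⟪EuclideanSpace.single k (1 : ℝ), U.starProjection (EuclideanSpace.single l 1)⟫ := by
    rw [Submodule.inner_starProjection_left_eq_right,
      Submodule.starProjection_eq_self_iff.2 (Submodule.starProjection_apply_mem _ _)]
  rw [h1, ← h2, map_add, map_sub, norm_add_sq_real, norm_sub_sq_real]
  ring

/-- The residual maker is a measurable function of the shocks of the controls. -/
lemma exists_measurable_residualMaker {Ω : Type*} {F : ℕ} (mu : ℕ → Fin F → ℝ)
    (eps : ℕ → ℤ → Ω → ℝ) (T J : ℕ) :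
    ∃ Φ : (Fin J → Fin T → ℝ) → Fin T → Fin T → ℝ, Measurable Φ ∧
      ∀ ω k l, residualMaker mu eps T J ω k l
        = Φ (fun j k => eps ((j : ℕ) + 1) (preTime k) ω) k l := by
  set N := LinearMap.ker (Matrix.toEuclideanLin (controlLoadings mu J)ᵀ) with hN
  refine ⟨fun E k l =>
    (‖(N.map (Matrix.toEuclideanLin (Matrix.of fun k j => E j k)))ᗮ.starProjection
            (EuclideanSpace.single k 1 + EuclideanSpace.single l 1)‖ ^ 2
    - ‖(N.map (Matrix.toEuclideanLin (Matrix.of fun k j => E j k)))ᗮ.starProjection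
            (EuclideanSpace.single k 1 - EuclideanSpace.single l 1)‖ ^ 2) / 4, ?_, ?_⟩
  · refine measurable_pi_lambda _ fun k => measurable_pi_lambda _ fun l => ?_
    exact (((measurable_norm_starProjection_map N _).pow_const 2).sub
      ((measurable_norm_starProjection_map N _).pow_const 2)).div_const 4
  · intro ω k l
    rw [residualMaker_apply_eq_polarization]
    rfl

lemma indepFun_residualMaker {Ω : Type*} [MeasurableSpace Ω] {P : Measure Ω}
    {F : ℕ} (mu : ℕ → Fin F → ℝ) {eps : ℕ → ℤ → Ω → ℝ} {T₁ : ℕ}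
    (hmeas : ∀ i t, Measurable (eps i t))
    (hind : iIndepFun (fun (i : ℕ) (ω : Ω) (t : {t : ℤ // t ≤ T₁}) => eps i t ω) P) (T J : ℕ) :
    IndepFun (fun (ω : Ω) (k l : Fin T) => residualMaker mu eps T J ω k l)
      (treatedShocks eps T) P := by
  obtain ⟨Φ, hΦ, hΦe⟩ := exists_measurable_residualMaker mu eps T J
  have hpre : ∀ k : Fin T, preTime k ≤ (T₁ : ℤ) := fun k => by simp only [preTime]; omega
  set s : Finset ℕ := Finset.Icc 1 J with hs
  have h := hind.indepFun_finset s {0} (by simp [hs])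
    fun i => measurable_pi_lambda _ fun t => hmeas i t
  have hmem : ∀ j : Fin J, (j : ℕ) + 1 ∈ s := fun j => by simp [hs]
  let φ : ((i : s) → {t : ℤ // t ≤ T₁} → ℝ) → Fin T → Fin T → ℝ :=
    fun z => Φ fun j k => z ⟨(j : ℕ) + 1, hmem j⟩ ⟨preTime k, hpre k⟩
  let ψ : ((i : ({0} : Finset ℕ)) → {t : ℤ // t ≤ T₁} → ℝ) → Fin T → ℝ :=
    fun z k => z ⟨0, by simp⟩ ⟨preTime k, hpre k⟩
  have hφ : Measurable φ := by
    refine hΦ.comp (measurable_pi_lambda _ fun j => measurable_pi_lambda _ fun k => ?_)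
    exact (measurable_pi_apply _).comp (measurable_pi_apply _)
  have hψ : Measurable ψ := by
    refine measurable_pi_lambda _ fun k => ?_
    exact (measurable_pi_apply _).comp (measurable_pi_apply _)
  have h' := h.comp hφ hψ
  have hQ : (fun (ω : Ω) (k l : Fin T) => residualMaker mu eps T J ω k l)
      = φ ∘ fun ω (i : s) (t : {t : ℤ // t ≤ T₁}) => eps i t ω := by
    funext ω k l
    exact hΦe ω k l
  rw [hQ]
  exact h'

/-! ### Moment bounds -/

section Moments
variable {Ω : Type*} [MeasurableSpace Ω] {P : Measure Ω} [IsProbabilityMeasure P]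

lemma integral_sq_le_one_add {X : Ω → ℝ} {C : ℝ} (hX : MemLp X 4 P)
    (hC : ∫ ω, X ω ^ 4 ∂P ≤ C) : ∫ ω, X ω ^ 2 ∂P ≤ 1 + C := by
  have h2 : MemLp X 2 P := hX.mono_exponent (by norm_num)
  have h4 : Integrable (fun ω => X ω ^ 4) P := by
    have := hX.integrable_norm_pow (p := 4) (by norm_num)
    simpa [Even.pow_abs (by decide : Even 4)] using this
  calc ∫ ω, X ω ^ 2 ∂P ≤ ∫ ω, (1 + X ω ^ 4) ∂P := by
        refine integral_mono h2.integrable_sq ((integrable_const 1).add h4) fun ω => ?_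
        simp only
        nlinarith [sq_nonneg (X ω ^ 2 - 1), sq_nonneg (X ω)]
    _ = 1 + ∫ ω, X ω ^ 4 ∂P := by
        rw [integral_add (integrable_const 1) h4]
        simp
    _ ≤ 1 + C := by gcongr

lemma integral_sq_sum_le_of_pairwise_indepFun {J : ℕ} {X : Fin J → Ω → ℝ} (w : Fin J → ℝ)
    {v : ℝ} (hX : ∀ j, MemLp (X j) 2 P) (h0 : ∀ j, ∫ ω, X j ω ∂P = 0)
    (hv : ∀ j, ∫ ω, X j ω ^ 2 ∂P ≤ v)
    (hind : Pairwise fun i j => IndepFun (X i) (X j) P) :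
    ∫ ω, (∑ j, X j ω * w j) ^ 2 ∂P ≤ v * ∑ j, w j ^ 2 := by
  set Y : Fin J → Ω → ℝ := fun j ω => X j ω * w j with hY
  have hYm : ∀ j, MemLp (Y j) 2 P := fun j => (hX j).mul_const (w j)
  have hY0 : ∀ j, ∫ ω, Y j ω ∂P = 0 := fun j => by
    simp only [hY, integral_mul_const, h0, zero_mul]
  have hsum0 : ∫ ω, (∑ j, Y j) ω ∂P = 0 := by
    simp only [Finset.sum_apply]
    rw [integral_finsetSum _ fun j _ => (hYm j).integrable (by norm_num)]
    simp [hY0]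
  have hvar := IndepFun.variance_sum (μ := P) (X := Y) (s := Finset.univ) (fun j _ => hYm j)
    (fun i _ j _ hij => (hind hij).comp (measurable_id.mul_const (w i))
      (measurable_id.mul_const (w j)))
  rw [variance_of_integral_eq_zero
    (Finset.aemeasurable_sum _ fun j _ => (hYm j).aemeasurable) hsum0] at hvar
  simp only [Finset.sum_apply] at hvar
  change ∫ ω, (∑ j, Y j ω) ^ 2 ∂P ≤ _
  rw [hvar, Finset.mul_sum]
  refine Finset.sum_le_sum fun j _ => ?_
  rw [variance_of_integral_eq_zero (hYm j).aemeasurable (hY0 j)]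
  simp only [hY, mul_pow, integral_mul_const]
  gcongr
  exact hv j

/-- Markov inequality for the squared norm of a vector with uniformly bounded second moments. -/
lemma measure_mul_lt_norm_sq_le {T : ℕ} (hT : 0 < T) {X : Ω → EuclideanSpace ℝ (Fin T)}
    (hX : ∀ k, MemLp (fun ω => X ω k) 2 P) {v : ℝ} (hv : ∀ k, ∫ ω, X ω k ^ 2 ∂P ≤ v)
    {a : ℝ} (ha : 0 < a) : P {ω | a * T < ‖X ω‖ ^ 2} ≤ ENNReal.ofReal (v / a) := by
  have hT' : (0 : ℝ) < T := by exact_mod_cast hT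
  have hnorm : ∀ ω, ‖X ω‖ ^ 2 = ∑ k, X ω k ^ 2 := fun ω => by
    rw [EuclideanSpace.norm_sq_eq]; simp
  have hint : Integrable (fun ω => ‖X ω‖ ^ 2) P := by
    simp only [hnorm]
    exact integrable_finsetSum _ fun k _ => (hX k).integrable_sq
  have hle : ∫ ω, ‖X ω‖ ^ 2 ∂P ≤ T * v := by
    simp only [hnorm]
    rw [integral_finsetSum _ fun k _ => (hX k).integrable_sq]
    refine (Finset.sum_le_sum fun k _ => hv k).trans ?_
    simp
  have hm := mul_meas_ge_le_integral_of_nonneg (μ := P)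
    (ae_of_all _ fun ω => sq_nonneg ‖X ω‖) hint (a * T)
  refine (measure_mono fun ω hω => ?_ : _ ≤ P {ω | a * T ≤ ‖X ω‖ ^ 2}).trans ?_
  · rw [Set.mem_ofPred_eq] at hω ⊢
    exact hω.le
  · rw [← ofReal_measureReal]
    refine ENNReal.ofReal_le_ofReal ?_
    rw [le_div_iff₀ ha]
    nlinarith

end Moments

/-! ### Finitely many events -/

section Events
variable {Ω : Type*} [MeasurableSpace Ω] {P : Measure Ω}

lemma tendsto_measure_exists_of_forall {ι : Type*} [Finite ι] {S : ι → ℕ → Set Ω}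
    (h : ∀ i, Tendsto (fun T => P (S i T)) atTop (𝓝 0)) :
    Tendsto (fun T => P {ω | ∃ i, ω ∈ S i T}) atTop (𝓝 0) := by
  have := Fintype.ofFinite ι
  have hsum : Tendsto (fun T => ∑ i, P (S i T)) atTop (𝓝 0) := by
    simpa using tendsto_finsetSum Finset.univ fun i _ => h i
  refine tendsto_of_tendsto_of_tendsto_of_le_of_le tendsto_const_nhds hsum (fun _ => zero_le)
    fun T => ?_
  have : {ω | ∃ i, ω ∈ S i T} = ⋃ i, S i T := by ext; simp
  rw [this]
  exact measure_iUnion_fintype_le P _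

/-- Finitely many sequences bounded in probability admit a common bound. -/
lemma IsBoundedInProbability.exists_forall {ι : Type*} [Finite ι] {X : ι → ℕ → Ω → ℝ}
    (h : ∀ i, IsBoundedInProbability P (X i)) {η : ℝ} (hη : 0 < η) :
    ∃ C, 0 ≤ C ∧ ∀ᶠ T in atTop, P {ω | ∃ i, C < |X i T ω|} ≤ ENNReal.ofReal η := by
  have := Fintype.ofFinite ι
  have hn : (0 : ℝ) < Fintype.card ι + 1 := by positivity
  choose C hC using fun i => h i (η / (Fintype.card ι + 1)) (by positivity)
  refine ⟨∑ i, |C i|, Finset.sum_nonneg fun _ _ => abs_nonneg _, ?_⟩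
  filter_upwards [eventually_all.2 hC] with T hT
  calc P {ω | ∃ i, ∑ i, |C i| < |X i T ω|} ≤ P (⋃ i, {ω | C i < |X i T ω|}) := by
        refine measure_mono ?_
        rintro ω ⟨i, hi⟩
        refine Set.mem_iUnion.2 ⟨i, lt_of_le_of_lt ?_ hi⟩
        exact (le_abs_self _).trans
          (Finset.single_le_sum (f := fun i => |C i|) (fun _ _ => abs_nonneg _) (Finset.mem_univ i))
    _ ≤ ∑ i, P {ω | C i < |X i T ω|} := measure_iUnion_fintype_le P _
    _ ≤ ∑ i : ι, ENNReal.ofReal (η / (Fintype.card ι + 1)) := Finset.sum_le_sum fun i _ => hT i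
    _ = ENNReal.ofReal (∑ i : ι, η / (Fintype.card ι + 1)) :=
        (ENNReal.ofReal_sum_of_nonneg fun _ _ => by positivity).symm
    _ ≤ ENNReal.ofReal η := by
        refine ENNReal.ofReal_le_ofReal ?_
        rw [Finset.sum_const, Finset.card_univ, nsmul_eq_mul, mul_div_assoc', div_le_iff₀ hn]
        nlinarith
end Events

/-! ### The shocks -/

section Shocks
variable {Ω : Type*} [MeasurableSpace Ω] {P : Measure Ω} [IsProbabilityMeasure P]
  {eps : ℕ → ℤ → Ω → ℝ} {J : ℕ → ℕ} {T₁ : ℕ}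

lemma ShockAssumption.exists_variance_bound (h : ShockAssumption P eps J T₁) :
    ∃ v : ℝ, 0 < v ∧ ∀ i, ∀ t : ℤ, t ≤ T₁ → MemLp (eps i t) 2 P ∧ ∫ ω, eps i t ω ^ 2 ∂P ≤ v := by
  obtain ⟨C, hC⟩ := h.fourth_moment
  refine ⟨1 + |C|, by positivity, fun i t ht => ⟨(hC i t ht).1.mono_exponent (by norm_num), ?_⟩⟩
  exact integral_sq_le_one_add (hC i t ht).1 ((hC i t ht).2.trans (le_abs_self C))

lemma preTime_le {T : ℕ} (k : Fin T) : preTime k ≤ (T₁ : ℤ) := by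
  simp only [preTime]; omega

lemma measure_treatedShocks_le {v : ℝ}
    (hv : ∀ i, ∀ t : ℤ, t ≤ T₁ → MemLp (eps i t) 2 P ∧ ∫ ω, eps i t ω ^ 2 ∂P ≤ v)
    {T : ℕ} (hT : 0 < T) {a : ℝ} (ha : 0 < a) :
    P {ω | a * T < ‖(WithLp.toLp 2 (treatedShocks eps T ω) : EuclideanSpace ℝ (Fin T))‖ ^ 2}
      ≤ ENNReal.ofReal (v / a) :=
  measure_mul_lt_norm_sq_le hT (fun k => (hv 0 _ (preTime_le k)).1)
    (fun k => (hv 0 _ (preTime_le k)).2) ha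

/-- The shocks of different units are uncorrelated, so each entry in column `f` of `E B` has
variance at most `v * ∑ j, B j f ^ 2`. -/
lemma ShockAssumption.measure_averagedShocks_le (h : ShockAssumption P eps J T₁) {v : ℝ}
    (hv : ∀ i, ∀ t : ℤ, t ≤ T₁ → MemLp (eps i t) 2 P ∧ ∫ ω, eps i t ω ^ 2 ∂P ≤ v)
    {T : ℕ} (hT : 0 < T) {F N : ℕ} (B : Matrix (Fin N) (Fin F) ℝ) (f : Fin F)
    {a : ℝ} (ha : 0 < a) :
    P {ω | a * T < ‖euclideanCol (controlShocks eps T N ω * B) f‖ ^ 2}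
      ≤ ENNReal.ofReal (v * (∑ j, B j f ^ 2) / a) := by
  refine measure_mul_lt_norm_sq_le hT (fun k => ?_) (fun k => ?_) ha
  · simp only [euclideanCol, Matrix.mul_apply, controlShocks, Matrix.of_apply]
    exact memLp_finsetSum _ fun j _ => (hv _ _ (preTime_le k)).1.mul_const _
  · simp only [euclideanCol, Matrix.mul_apply, controlShocks, Matrix.of_apply]
    refine integral_sq_sum_le_of_pairwise_indepFun (X := fun j => eps ((j : ℕ) + 1) (preTime k)) _
      (fun j => (hv _ _ (preTime_le k)).1) (fun j => h.mean_zero _ _ (preTime_le k))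
      (fun j => (hv _ _ (preTime_le k)).2) fun i j hij => ?_
    have hne : (i : ℕ) + 1 ≠ (j : ℕ) + 1 := fun e => hij (Fin.ext (by omega))
    exact (h.indep.indepFun hne).comp (measurable_pi_apply ⟨preTime k, preTime_le k⟩)
      (measurable_pi_apply ⟨preTime k, preTime_le k⟩)
end Shocks

/-! ### Consistency -/

lemma eventually_mul_le_rank_residualMaker {Ω : Type*} {F : ℕ} {J : ℕ → ℕ} {c : ℝ} (hc₁ : c < 1)
    (hJ : Tendsto (fun T : ℕ => (J T : ℝ) / (T : ℝ)) atTop (𝓝 c))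
    (mu : ℕ → Fin F → ℝ) (eps : ℕ → ℤ → Ω → ℝ) :
    ∀ᶠ T : ℕ in atTop, ∀ ω, (1 - c) / 2 * T ≤ (residualMaker mu eps T (J T) ω).rank := by
  filter_upwards [hJ.eventually_lt_const (show c < (1 + c) / 2 by linarith),
    eventually_gt_atTop 0] with T hT hT0 ω
  have hT0' : (0 : ℝ) < T := by exact_mod_cast hT0
  rw [div_lt_iff₀ hT0'] at hT
  have : (T : ℝ) ≤ (residualMaker mu eps T (J T) ω).rank + J T := by
    exact_mod_cast le_rank_residualMaker_add mu eps T (J T) ω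
  linarith

lemma tendsto_measure_averagedShocks {Ω : Type*} [MeasurableSpace Ω] {P : Measure Ω}
    [IsProbabilityMeasure P] {F : ℕ} {T₁ : ℕ} {J : ℕ → ℕ} {mu : ℕ → Fin F → ℝ}
    {eps : ℕ → ℤ → Ω → ℝ} (h_shocks : ShockAssumption P eps J T₁) {a b : ℝ}
    (h_loadings : Tendsto (fun T : ℕ => groupCount mu a b (J T)) atTop atTop)
    {B : (T : ℕ) → Matrix (Fin (J T)) (Fin F) ℝ}
    (hB : ∀ᶠ T in atTop, ∀ f,
      ∑ j, B T j f ^ 2 ≤ F * (a ^ 2)⁻¹ * (groupCount mu a b (J T) : ℝ)⁻¹)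
    {q : ℝ} (hq : 0 < q) (f : Fin F) :
    Tendsto (fun T : ℕ => P {ω | q * T < ‖euclideanCol (controlShocks eps T (J T) ω * B T) f‖ ^ 2})
      atTop (𝓝 0) := by
  obtain ⟨v, hv0, hv⟩ := h_shocks.exists_variance_bound
  have hinv : Tendsto (fun T => ENNReal.ofReal
      (v * (F * (a ^ 2)⁻¹ * (groupCount mu a b (J T) : ℝ)⁻¹) / q)) atTop (𝓝 0) := by
    have h1 : Tendsto (fun T => (groupCount mu a b (J T) : ℝ)⁻¹) atTop (𝓝 0) :=
      tendsto_inv_atTop_zero.comp (tendsto_natCast_atTop_atTop.comp h_loadings)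
    have h2 := ((h1.const_mul (F * (a ^ 2)⁻¹)).const_mul v).div_const q
    simp only [mul_zero, zero_div] at h2
    simpa using ENNReal.tendsto_ofReal h2
  refine tendsto_of_tendsto_of_tendsto_of_le_of_le' tendsto_const_nhds hinv
    (Eventually.of_forall fun _ => zero_le) ?_
  filter_upwards [hB, eventually_gt_atTop 0] with T hT hT0
  refine (h_shocks.measure_averagedShocks_le hv hT0 (B T) f hq).trans (ENNReal.ofReal_le_ofReal ?_)
  gcongr
  exact hT f

/-- The error of the implied loadings on an event where the moments are bounded, and the averaged
shocks and the cross term are small. The rank of the residual maker enters only through `ρ * T`, a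
deterministic lower bound. -/
lemma sum_abs_impliedLoadings_sub_le {Ω : Type*} {F : ℕ} (lam : ℤ → Fin F → ℝ)
    (mu : ℕ → Fin F → ℝ) (alpha : ℕ → ℤ → ℝ) (eps : ℕ → ℤ → Ω → ℝ) {T J : ℕ} (hT : 0 < T)
    {ω : Ω} {b : Fin J → ℝ}
    (hb : IsOLS (fun i t => observedOutcome lam mu alpha eps i t ω) T J b)
    {B : Matrix (Fin J) (Fin F) ℝ} (hB : (controlLoadings mu J)ᵀ * B = 1)
    {ρ D L s θ : ℝ} (hρ : 0 < ρ) (hD : 0 ≤ D) (hL : 0 ≤ L) (hs : 0 ≤ s) (hθ : 0 ≤ θ) (hθ₁ : θ ≤ 1)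
    (hrank : ρ * T ≤ (residualMaker mu eps T J ω).rank)
    (hunit : IsUnit (projectedMoment lam T (residualMaker mu eps T J ω)).det)
    (hinv : ∀ f g, |(projectedMoment lam T (residualMaker mu eps T J ω))⁻¹ f g| ≤ D)
    (hdiag : ∀ f, projectedMoment lam T (residualMaker mu eps T J ω) f f ≤ L ^ 2)
    (he : ∀ f, ‖euclideanCol (controlShocks eps T J ω * B) f‖ ^ 2 ≤ θ ^ 2 * ρ * T)
    (hu : ‖(WithLp.toLp 2 (treatedShocks eps T ω) : EuclideanSpace ℝ (Fin T))‖ ^ 2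
      ≤ s ^ 2 * ρ * T)
    (hcross : ∀ f, |projectedCross lam T (residualMaker mu eps T J ω)
      (treatedShocks eps T ω) f| ≤ θ)
    (hsmall : θ * ((F : ℝ) ^ 2 * D * (2 * L + 1)) ≤ 1 / 2) :
    ∑ f, |(impliedLoadings mu J b - mu 0) f|
      ≤ θ * (2 * (F : ℝ) ^ 2 * D * (1 + s + (2 * L + 1) * ∑ f, |mu 0 f|)) := by
  have hT' : (0 : ℝ) < T := by exact_mod_cast hT
  have hκ : (0 : ℝ) < (residualMaker mu eps T J ω).rank := lt_of_lt_of_le (by positivity) hrank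
  refine sum_abs_sub_le_of_normalEquations _ _ _ _ _ _
    (normalEquations lam mu alpha eps hT hb hB) hκ hD hL hs hθ hθ₁
    (projectedMoment_residualMaker lam mu eps T J ω) hunit hinv hdiag
    (fun f => (he f).trans ?_) (hu.trans ?_) (fun f => ?_) hsmall
  · rw [mul_assoc]; gcongr
  · rw [mul_assoc]; gcongr
  · rw [← projectedCross_residualMaker]
    exact hcross f

end SyntheticControl

open SyntheticControl

theorem proposition2 {Ω : Type*} [MeasurableSpace Ω] (P : Measure Ω) [IsProbabilityMeasure P]
    {F : ℕ} (T₁ : ℕ) (J : ℕ → ℕ)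
    (lam : ℤ → Fin F → ℝ) (mu : ℕ → Fin F → ℝ) (alpha : ℕ → ℤ → ℝ) (eps : ℕ → ℤ → Ω → ℝ)
    (c : ℝ) (hc₀ : 0 ≤ c) (hc₁ : c < 1)
    (hJ : Tendsto (fun T : ℕ => (J T : ℝ) / (T : ℝ)) atTop (𝓝 c))
    (h_shocks : SyntheticControl.ShockAssumption P eps J T₁)
    (a_low a_high : ℝ) (ha_low : 0 < a_low) (ha_high : 0 < a_high)
    (h_loadings : Tendsto (fun T : ℕ => SyntheticControl.groupCount mu a_low a_high (J T))
      atTop atTop)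
    (h_factors : SyntheticControl.FactorAssumption P lam eps
      (fun T ω => SyntheticControl.residualMaker mu eps T (J T) ω))
    (b : (T : ℕ) → Ω → Fin (J T) → ℝ)
    (hb : ∀ (T : ℕ) (ω : Ω), SyntheticControl.IsOLS
      (fun i t => SyntheticControl.observedOutcome lam mu alpha eps i t ω) T (J T) (b T ω)) :
    TendstoInMeasure P (fun T ω => SyntheticControl.impliedLoadings mu (J T) (b T ω))
      atTop (fun _ => mu 0) := by
  obtain ⟨v, hv0, hv⟩ := h_shocks.exists_variance_bound
  have hρ : 0 < (1 - c) / 2 := by linarith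
  have hrank := eventually_mul_le_rank_residualMaker hc₁ hJ mu eps
  set ρ := (1 - c) / 2
  have hpos : ∀ᶠ T in atTop, 0 < groupCount mu a_low a_high (J T) :=
    h_loadings.eventually_gt_atTop 0
  -- Balancing weights exist once there is a well-conditioned group; the value `0` for the other `T`
  -- is immaterial.
  have hex : ∀ T, ∃ B : Matrix (Fin (J T)) (Fin F) ℝ, 0 < groupCount mu a_low a_high (J T) →
      (controlLoadings mu (J T))ᵀ * B = 1 ∧ ∀ f, ∑ j, B j f ^ 2 ≤
        F * (a_low ^ 2)⁻¹ * (groupCount mu a_low a_high (J T) : ℝ)⁻¹ := fun T => by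
    by_cases h : 0 < groupCount mu a_low a_high (J T)
    · obtain ⟨B, hB⟩ := exists_balancing_weights mu ha_low h
      exact ⟨B, fun _ => hB⟩
    · exact ⟨0, fun h' => absurd h' h⟩
  choose B hB using hex
  rw [tendstoInMeasure_iff_norm]
  intro ε hε
  rw [ENNReal.tendsto_nhds_zero]
  intro δ hδ
  obtain ⟨r, hr0, hrδ⟩ := ENNReal.lt_iff_exists_nnreal_btwn.1 hδ
  -- Six exceptional events, of probability at most `r / 6` each.
  have hη : (0 : ℝ) < r / 6 := by
    have : (0 : ℝ) < r := by exact_mod_cast hr0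
    positivity
  obtain ⟨C, hC0, hC⟩ := IsBoundedInProbability.exists_forall
    (fun f => h_factors.moment_bounded f f) hη
  obtain ⟨D, hD0, hD⟩ := IsBoundedInProbability.exists_forall
    (fun p : Fin F × Fin F => h_factors.inverse_bounded p.1 p.2) hη
  set η : ℝ := r / 6 with hη_def
  set L := 1 + C
  -- The level at which the Markov bound for the shocks of the treated unit equals `η`.
  set s := √(v / (ρ * η))
  have hs : s ^ 2 * ρ = v / η := by
    rw [Real.sq_sqrt (by positivity)]
    field_simp
  set N₁ := (F : ℝ) ^ 2 * D * (2 * L + 1)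
  set N₂ := 2 * (F : ℝ) ^ 2 * D * (1 + s + (2 * L + 1) * ∑ f, |mu 0 f|)
  have hm0 : 0 ≤ ∑ f, |mu 0 f| := Finset.sum_nonneg fun _ _ => abs_nonneg _
  have hN₁0 : 0 ≤ N₁ := by positivity
  have hN₂0 : 0 ≤ N₂ := by positivity
  obtain ⟨θ, hθ0, hθ₁, hθN₁, hθN₂⟩ : ∃ θ : ℝ, 0 < θ ∧ θ ≤ 1 ∧ θ * N₁ ≤ 1 / 2 ∧ θ * N₂ < ε := by
    refine ⟨min 1 (min (1 / (2 * (N₁ + 1))) (ε / (N₂ + 1))), by positivity, min_le_left _ _, ?_, ?_⟩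
    · calc _ ≤ 1 / (2 * (N₁ + 1)) * N₁ := by
            gcongr
            exact (min_le_right _ _).trans (min_le_left _ _)
        _ ≤ 1 / 2 := by
            rw [div_mul_eq_mul_div, div_le_div_iff₀ (by positivity) (by positivity)]
            linarith
    · calc _ ≤ ε / (N₂ + 1) * N₂ := by
            gcongr
            exact (min_le_right _ _).trans (min_le_right _ _)
        _ < ε := by
            rw [div_mul_eq_mul_div, div_lt_iff₀ (by positivity)]
            linarith
  have hcross := tendsto_measure_exists_of_forall fun f =>
    (tendstoInMeasure_iff_norm.1 (h_factors.cross_negligible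
      (fun T => indepFun_residualMaker mu h_shocks.measurable h_shocks.indep T (J T)) f)) θ hθ0
  have havg := tendsto_measure_exists_of_forall fun f =>
    tendsto_measure_averagedShocks h_shocks h_loadings
      (hpos.mono fun T hT => (hB T hT).2) (show 0 < θ ^ 2 * ρ by positivity) f
  have hη' : 0 < ENNReal.ofReal η := ENNReal.ofReal_pos.2 hη
  filter_upwards [hrank, hpos, hC, hD, eventually_gt_atTop 0,
    (ENNReal.tendsto_nhds_zero.1 hcross) _ hη', (ENNReal.tendsto_nhds_zero.1 havg) _ hη',
    (ENNReal.tendsto_nhds_zero.1 h_factors.moment_invertible) _ hη']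
    with T hrankT hposT hCT hDT hT0 hcrossT havgT hinvT
  have hshockT := measure_treatedShocks_le hv hT0 (show 0 < s ^ 2 * ρ by
    rw [hs]; positivity)
  rw [show v / (s ^ 2 * ρ) = η by rw [hs]; field_simp] at hshockT
  have hsub : {ω | ε ≤ ‖impliedLoadings mu (J T) (b T ω) - mu 0‖} ⊆
      {ω | ¬ IsUnit (projectedMoment lam T (residualMaker mu eps T (J T) ω)).det} ∪
      ({ω | ∃ p : Fin F × Fin F,
          D < |(projectedMoment lam T (residualMaker mu eps T (J T) ω))⁻¹ p.1 p.2|} ∪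
      ({ω | ∃ f, θ ^ 2 * ρ * T < ‖euclideanCol (controlShocks eps T (J T) ω * B T) f‖ ^ 2} ∪
      ({ω | s ^ 2 * ρ * T <
          ‖(WithLp.toLp 2 (treatedShocks eps T ω) : EuclideanSpace ℝ (Fin T))‖ ^ 2} ∪
      ({ω | ∃ f, C < |projectedMoment lam T (residualMaker mu eps T (J T) ω) f f|} ∪
        {ω | ∃ f, θ ≤ ‖projectedCross lam T (residualMaker mu eps T (J T) ω)
          (treatedShocks eps T ω) f - 0‖})))) := by
    intro ω hω
    rw [Set.mem_ofPred_eq] at hω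
    by_contra hnot
    simp only [Set.mem_union, not_or, Set.mem_ofPred_eq] at hnot
    obtain ⟨n1, n2, n3, n4, n5, n6⟩ := hnot
    refine absurd (sum_abs_impliedLoadings_sub_le lam mu alpha eps hT0 (hb T ω) (hB T hposT).1
      hρ hD0 (show 0 ≤ L by positivity) (Real.sqrt_nonneg _) hθ0.le hθ₁ (hrankT ω)
      (not_not.1 n1) (fun f g => not_lt.1 fun h => n2 ⟨(f, g), h⟩)
      (fun f => ?_) (fun f => not_lt.1 fun h => n3 ⟨f, h⟩) (not_lt.1 n4)
      (fun f => ?_) hθN₁) (not_le.2 (hθN₂.trans_le ?_))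
    · refine le_trans (not_lt.1 fun h => n5 ⟨f, h.trans_le (le_abs_self _)⟩ : _ ≤ C) ?_
      nlinarith
    · refine le_of_not_ge fun h => n6 ⟨f, ?_⟩
      simpa using h
    · refine le_trans hω ((pi_norm_le_iff_of_nonneg (Finset.sum_nonneg fun _ _ => abs_nonneg _)).2
        fun f => ?_)
      exact Finset.single_le_sum (f := fun f => |(impliedLoadings mu (J T) (b T ω) - mu 0) f|)
        (fun _ _ => abs_nonneg _) (Finset.mem_univ f)
  refine (measure_mono hsub).trans ?_
  calc _ ≤ ENNReal.ofReal η + (ENNReal.ofReal η + (ENNReal.ofReal η + (ENNReal.ofReal η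
          + (ENNReal.ofReal η + ENNReal.ofReal η)))) := by
        refine (measure_union_le _ _).trans (add_le_add hinvT ?_)
        refine (measure_union_le _ _).trans (add_le_add hDT ?_)
        refine (measure_union_le _ _).trans (add_le_add havgT ?_)
        refine (measure_union_le _ _).trans (add_le_add hshockT ?_)
        exact (measure_union_le _ _).trans (add_le_add hCT hcrossT)
    _ = r := by
        iterate 5 rw [← ENNReal.ofReal_add (by positivity) (by positivity)]
        rw [← ENNReal.ofReal_coe_nnreal]
        congr 1
        rw [hη_def]; ring
    _ ≤ δ := hrδ.le
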